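/- Let $\Theta=\prod_{i=1}^d\Theta_i$ with nonempty finite sets $\Theta_i\subset\mathbb R$, let $U:\Theta\to\mathbb R$ (for instance the restriction of a differentiable function on $\mathbb R^d$), $\pi(\theta)=e^{U(\theta)}/Z$ with $Z=\sum_{\theta\in\Theta}e^{U(\theta)}$, and let $\eta>0$. On $\Theta\times\mathbb R^d$ let $p$ be the joint distribution with density, with respect to counting measure times Lebesgue measure, $$p(\theta,a)=(4\eta)^{-d}Z^{-1}\exp\Big\{U(\theta)-2\sum_{i=1}^d\ln\cosh\Big(\frac{a_i-\theta_i}{2\eta}\Big)\Big\},$$ and let $p(\cdot\mid a)$ be its conditional distribution on $\Theta$ given $a$. Let $q_{\rm noise}(a\mid\theta)=\prod_{i}\frac1{4\eta}\operatorname{sech}^2\big(\frac{a_i-\theta_i}{2\eta}\big)$ (independent coordinates $a_i\sim\mathrm{Logistic}(\theta_i,\eta)$) and $$q_{\rm denoise}(\theta\mid a)=\prod_{i=1}^d\frac{\exp\{-2\ln\cosh((a_i-\theta_i)/2\eta)\}}{\sum_{t\in\Theta_i}\exp\{-2\ln\cosh((a_i-t)/2\eta)\}}.$$ Let the inner sampler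 $\Phi$ be a Markov kernel from $\Theta\times\mathbb R^d$ to $\Theta$, and let $L\ge 0$ and $G\ge 1$ be integers. One Gibbs sweep of HiSS moves from $(\theta,a_{\rm old})$ to $(\theta_{\rm new},a)$ as follows: (1) sample $a\sim q_{\rm noise}(\cdot\mid\theta)$; (2) propose $\theta'\sim q_{\rm denoise}(\cdot\mid a)$; (3) set $\theta_{\rm init}=\theta'$ with probability $$\min\Big(1,\frac{\pi(\theta')\,q_{\rm noise}(a\mid\theta')\,q_{\rm denoise}(\theta\mid a)}{\pi(\theta)\,q_{\rm noise}(a\mid\theta)\,q_{\rm denoise}(\theta'\mid a)}\Big),$$ and $\theta_{\rm init}=\theta$ otherwise; (4) obtain $\theta_{\rm new}$ from $\theta_{\rm init}$ by $L$ steps of $\Phi(\cdot\mid\cdot,a)$ with $a$ fixed. Let $K$ be the transition kernel of $G$ consecutive sweeps, on $\Theta\times\mathbb R^d$. Then $p$ is a probability distribution, $K$ is a Markov kernel, and the following hold. (i) If $\Phi$ is a sampler for the conditionals of $p$, that is, if $\Phi(\cdot\mid\cdot,a)$ leaves $p(\cdot\mid a)$ invariant for every $a\in\mathbb R^d$, then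 the chain generated by HiSS is irreducible and positive recurrent for $p$: $p$ is invariant under $K$; $K$ is $p$-irreducible; and for every measurable $A$ with $p(A)>0$ and every starting point $x$, $\sum_{n\ge1}K^n(x,A)=\infty$, the chain started at $x$ almost surely visits $A$ infinitely often, and the expected time of its first visit to $A$ at a time $n\ge1$ is finite. (ii) If $\Phi$ is any inner sampler, not necessarily preserving these conditionals, that makes no state unreachable, that is, if for every $a\in\mathbb R^d$ and $\theta'\in\Theta$ there is $\theta\in\Theta$ with $\Phi(\theta'\mid\theta,a)>0$, then all the assertions in (i) other than the invariance of $p$ still hold: $K$ is $p$-irreducible, and for all $A$ and $x$ as in (i) the sum is infinite, $A$ is almost surely visited infinitely often, and the expected return time is finite. -/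

import Mathlib

open MeasureTheory ProbabilityTheory Filter
open scoped ENNReal

noncomputable section

namespace HiSS

/-! ### Recurrence of Markov chains on a general state space -/

section MarkovChain

variable {α : Type*} [MeasurableSpace α]

/-- The law, on the space of trajectories `ℕ → α`, of the time-homogeneous Markov chain with
transition kernel `κ` started at `x`. -/
def chainLaw (κ : Kernel α α) [IsMarkovKernel κ] (x : α) : Measure (ℕ → α) :=
  Kernel.traj (X := fun _ : ℕ => α)
    (fun n => κ.comap (fun h : (i : Finset.Iic n) → α => h ⟨n, Finset.mem_Iic.2 le_rfl⟩)
      (measurable_pi_apply _)) 0 (fun _ => x)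

/-- The first time `n ≥ 1` at which the trajectory `ω` is in `A` (`∞` if there is none). -/
def returnTime (A : Set α) (ω : ℕ → α) : ℝ≥0∞ :=
  ⨅ (n : ℕ) (_ : 1 ≤ n ∧ ω n ∈ A), (n : ℝ≥0∞)

/-- Recurrence of a `φ`-irreducible kernel: the chain is `φ`-irreducible, and from every starting
point the expected number of visits `∑_{n ≥ 1} κⁿ(x, A)` to every measurable set `A` with
`φ A > 0` is infinite. -/
def IsRecurrent (φ : Measure α) (κ : Kernel α α) : Prop :=
  Kernel.IsIrreducible φ κ ∧
    ∀ A : Set α, MeasurableSet A → 0 < φ A → ∀ x : α, ∑' n : ℕ, (κ ^ (n + 1)) x A = ∞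

/-- From every starting point, every measurable set `A` with `φ A > 0` is almost surely visited
infinitely often. -/
def VisitsInfinitelyOften (φ : Measure α) (κ : Kernel α α) [IsMarkovKernel κ] : Prop :=
  ∀ A : Set α, MeasurableSet A → 0 < φ A → ∀ x : α,
    ∀ᵐ ω ∂(chainLaw κ x), ∃ᶠ n in atTop, ω n ∈ A

/-- From every starting point, the expected return time to every measurable set `A` with
`φ A > 0` is finite. -/
def HasFiniteMeanReturnTimes (φ : Measure α) (κ : Kernel α α) [IsMarkovKernel κ] : Prop :=
  ∀ A : Set α, MeasurableSet A → 0 < φ A → ∀ x : α,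
    ∫⁻ ω, returnTime A ω ∂(chainLaw κ x) < ∞

end MarkovChain

/-! ### Target distributions -/

variable {d : ℕ}

/-- The discrete domain `Θ₁ × ⋯ × Θ_d`. -/
abbrev Dom (Θ : Fin d → Finset ℝ) : Type := (i : Fin d) → Θ i

variable {Θ : Fin d → Finset ℝ}

/-- The coupling energy `-2 ln cosh ((a - θ) / (2η))`, summed over the coordinates. -/
def coupling (η : ℝ) (θ : Dom Θ) (a : Fin d → ℝ) : ℝ :=
  ∑ i, -2 * Real.log (Real.cosh ((a i - (θ i : ℝ)) / (2 * η)))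

/-- The normalizing constant `Z = ∑_θ exp (U θ)`. -/
def partitionZ (U : Dom Θ → ℝ) : ℝ := ∑ θ, Real.exp (U θ)

/-- The probability mass function `π(θ) = exp (U θ) / Z` of the target. -/
def targetProb (U : Dom Θ → ℝ) (θ : Dom Θ) : ℝ := Real.exp (U θ) / partitionZ U

/-- The joint density
`p(θ, a) = (4η)^{-d} Z^{-1} exp (U θ - 2 ∑ᵢ ln cosh ((aᵢ - θᵢ) / (2η)))`. -/
def jointDensity (U : Dom Θ → ℝ) (η : ℝ) (x : Dom Θ × (Fin d → ℝ)) : ℝ :=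
  Real.exp (U x.1 + coupling η x.1 x.2) / ((4 * η) ^ d * partitionZ U)

/-- The joint distribution on `Θ × ℝ^d`, with density `p(θ, a)` with respect to counting measure
times Lebesgue measure. -/
def jointMeasure (U : Dom Θ → ℝ) (η : ℝ) : Measure (Dom Θ × (Fin d → ℝ)) :=
  (Measure.count.prod volume).withDensity fun x => ENNReal.ofReal (jointDensity U η x)

/-- The conditional probabilities `p(θ | a)`. -/
def condProb (U : Dom Θ → ℝ) (η : ℝ) (a : Fin d → ℝ) (θ : Dom Θ) : ℝ :=
  Real.exp (U θ + coupling η θ a) / ∑ θ', Real.exp (U θ' + coupling η θ' a)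

/-- The conditional distribution `p(· | a)` on `Θ`. -/
def condMeasure (U : Dom Θ → ℝ) (η : ℝ) (a : Fin d → ℝ) : Measure (Dom Θ) :=
  ∑ θ, ENNReal.ofReal (condProb U η a θ) • Measure.dirac θ

/-! ### Noising -/

/-- The density `(1 / (4η)) sech² ((t - m) / (2η))` of the logistic distribution on `ℝ`. -/
def logisticDensity (m η t : ℝ) : ℝ :=
  1 / (4 * η) * (1 / Real.cosh ((t - m) / (2 * η))) ^ 2

/-- The logistic distribution on `ℝ` with location `m` and scale `η`. -/
def logisticMeasure (m η : ℝ) : Measure ℝ :=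
  volume.withDensity fun t => ENNReal.ofReal (logisticDensity m η t)

/-- The density `q_noise(a | θ)`: independent logistic coordinates. -/
def noiseDensity (η : ℝ) (θ : Dom Θ) (a : Fin d → ℝ) : ℝ :=
  ∏ i, logisticDensity (θ i : ℝ) η (a i)

/-- The noising kernel `θ ↦ Logistic(θ, η)` from `Θ` to `ℝ^d`, with independent coordinates. -/
def noiseKernel (η : ℝ) : Kernel (Dom Θ) (Fin d → ℝ) where
  toFun θ := Measure.pi fun i => logisticMeasure (θ i : ℝ) η
  measurable' := measurable_of_countable _

/-! ### Denoising and the Metropolis-Hastings step -/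

/-- `q_denoise(θ | a)`: the product over the coordinates of the softmax, over the candidates
`t ∈ Θᵢ`, of the energies `-2 ln cosh ((aᵢ - t) / (2η))`. -/
def denoiseProb (η : ℝ) (a : Fin d → ℝ) (θ : Dom Θ) : ℝ :=
  ∏ i, Real.exp (-2 * Real.log (Real.cosh ((a i - (θ i : ℝ)) / (2 * η)))) /
    ∑ t : Θ i, Real.exp (-2 * Real.log (Real.cosh ((a i - (t : ℝ)) / (2 * η))))

/-- The acceptance probability of the proposal `θ'` from the current state `θ`, given `a`. -/
def acceptProb (U : Dom Θ → ℝ) (η : ℝ) (a : Fin d → ℝ) (θ θ' : Dom Θ) : ℝ :=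
  min 1 ((targetProb U θ' * noiseDensity η θ' a * denoiseProb η a θ) /
    (targetProb U θ * noiseDensity η θ a * denoiseProb η a θ'))

/-- The probability that the Metropolis-Hastings step, given `a`, moves from `θ` to `θ'`: either
`θ'` is proposed and accepted, or `θ' = θ` and the proposal is rejected. -/
def mwgProb (U : Dom Θ → ℝ) (η : ℝ) (a : Fin d → ℝ) (θ θ' : Dom Θ) : ℝ :=
  denoiseProb η a θ' * acceptProb U η a θ θ' +
    if θ' = θ then ∑ ξ, denoiseProb η a ξ * (1 - acceptProb U η a θ ξ) else 0

theorem measurable_mwgProb (U : Dom Θ → ℝ) (η : ℝ) (θ' : Dom Θ) :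
    Measurable fun x : Dom Θ × (Fin d → ℝ) => mwgProb U η x.2 x.1 θ' := by
  refine measurable_from_prod_countable_right fun θ => ?_
  have hc : Measurable Real.cosh := Real.continuous_cosh.measurable
  have hl : ∀ m : ℝ, ∀ i : Fin d, Measurable fun a : Fin d → ℝ =>
      Real.cosh ((a i - m) / (2 * η)) := fun m i => hc.comp (by fun_prop)
  have hd : ∀ ξ : Dom Θ, Measurable fun a : Fin d → ℝ => denoiseProb η a ξ := by
    intro ξ
    unfold denoiseProb
    fun_prop
  have hn : ∀ ξ : Dom Θ, Measurable fun a : Fin d → ℝ => noiseDensity η ξ a := by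
    intro ξ
    unfold noiseDensity logisticDensity
    fun_prop
  have ha : ∀ ξ : Dom Θ, Measurable fun a : Fin d → ℝ => acceptProb U η a θ ξ := by
    intro ξ
    unfold acceptProb
    fun_prop
  unfold mwgProb
  by_cases h : θ' = θ
  · simp only [h, if_true]
    fun_prop
  · simp only [h, if_false]
    fun_prop

/-- The Metropolis-within-Gibbs kernel `(θ, a) ↦ θ_init`. -/
def mwgKernel (U : Dom Θ → ℝ) (η : ℝ) : Kernel (Dom Θ × (Fin d → ℝ)) (Dom Θ) where
  toFun x := ∑ θ', ENNReal.ofReal (mwgProb U η x.2 x.1 θ') • Measure.dirac θ'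
  measurable' := by
    refine Measure.measurable_of_measurable_coe _ fun s _ => ?_
    simp only [Measure.coe_finsetSum, Finset.sum_apply, Measure.smul_apply, smul_eq_mul]
    exact Finset.measurable_sum _ fun θ' _ =>
      ((measurable_mwgProb U η θ').ennreal_ofReal).mul_const _

/-! ### The algorithm -/

/-- Replace `a` by a fresh sample of `q_noise(· | θ)`. -/
def noiseStep (η : ℝ) : Kernel (Dom Θ × (Fin d → ℝ)) (Dom Θ × (Fin d → ℝ)) :=
  (Kernel.deterministic Prod.fst measurable_fst) ×ₖ ((noiseKernel η).comap Prod.fst measurable_fst)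

/-- Update `θ` by the kernel `Ψ`, given `a`, and keep `a`. -/
def updateDiscrete (Ψ : Kernel (Dom Θ × (Fin d → ℝ)) (Dom Θ)) :
    Kernel (Dom Θ × (Fin d → ℝ)) (Dom Θ × (Fin d → ℝ)) :=
  Ψ ×ₖ (Kernel.deterministic Prod.snd measurable_snd)

/-- One Gibbs sweep: noising, the denoising proposal with its Metropolis-Hastings correction, and
`L` steps of the inner sampler `Φ` with `a` fixed. -/
def sweep (U : Dom Θ → ℝ) (η : ℝ) (Φ : Kernel (Dom Θ × (Fin d → ℝ)) (Dom Θ)) (L : ℕ) :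
    Kernel (Dom Θ × (Fin d → ℝ)) (Dom Θ × (Fin d → ℝ)) :=
  ((updateDiscrete Φ) ^ L) ∘ₖ ((updateDiscrete (mwgKernel U η)) ∘ₖ (noiseStep η))

/-- One iteration of the outer loop: `G` Gibbs sweeps. -/
def hissKernel (U : Dom Θ → ℝ) (η : ℝ) (Φ : Kernel (Dom Θ × (Fin d → ℝ)) (Dom Θ)) (L G : ℕ) :
    Kernel (Dom Θ × (Fin d → ℝ)) (Dom Θ × (Fin d → ℝ)) :=
  (sweep U η Φ L) ^ G

end HiSS

end

/-!
The law of one sweep depends on its starting point only through the discrete component, since the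
old value of `a` is discarded. The noise density is positive everywhere, the Metropolis-Hastings
step given `a` moves between any two discrete states with positive probability (`mwgProb_pos`), and
an inner sampler without unreachable states can end at any discrete state after `L` steps, when
started suitably (`exists_pow_updateDiscrete_pos`). Hence a sweep from any point charges every set
`A` with `p(A) > 0` (`sweep_apply_pos`), and as there are finitely many discrete states it does so
with a probability bounded below by some `ε > 0` that does not depend on the starting point
(`exists_le_sweep_apply`). No uniformity of the inner sampler in `a` is needed for this.

The bound passes to the `G`-fold iterate. By the Markov property, a chain that hits `A` with
probability at least `ε` at every step avoids `A` during `n` given consecutive steps with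
probability at most `(1 - ε) ^ n` (`chainLaw_avoid_le`), from which irreducibility, recurrence,
infinitely many visits and finite expected return times follow (`recurrent_of_uniform_hitting`).

If the inner sampler preserves the conditionals of `p`, then it leaves no state unreachable, because
these conditionals charge every state, so the above applies. Moreover each of the three steps of a
sweep preserves `p`: under `p`, noising resamples `a` from its conditional distribution given `θ`;
the Metropolis-Hastings step is in detailed balance with `p(·, a)`; and the inner sampler preserves
`p(· | a)` by assumption (`invariant_hissKernel`). That `p` has total mass one reduces to the
logistic density being the derivative of a rescaled sigmoid.
-/

namespace HiSS

/-! ### Chains that hit a set with uniformly positive probability -/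

section UniformHitting

variable {α : Type*} [MeasurableSpace α] {κ : Kernel α α}

/-- The return time is at most the number of `n` such that no state at the times `1, …, n` is
in `A`. -/
theorem returnTime_le_tsum {α : Type*} (A : Set α) (ω : ℕ → α) :
    returnTime A ω ≤
      ∑' n : ℕ, {ω : ℕ → α | ∀ k, 0 < k → k ≤ 0 + n → ω k ∉ A}.indicator 1 ω := by
  classical
  by_cases h : ∃ n, 1 ≤ n ∧ ω n ∈ A
  · refine (iInf₂_le (Nat.find h) (Nat.find_spec h)).trans ?_
    refine le_trans ?_ (ENNReal.sum_le_tsum (Finset.range (Nat.find h)))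
    rw [Finset.sum_congr rfl fun n hn => Set.indicator_of_mem (f := (1 : (ℕ → α) → ℝ≥0∞)) ?_]
    · simp
    · intro k hk hkn hkA
      exact Nat.find_min h (m := k) (by have := Finset.mem_range.1 hn; lia) ⟨hk, hkA⟩
  · push Not at h
    rw [tsum_congr fun n => Set.indicator_of_mem (f := (1 : (ℕ → α) → ℝ≥0∞))
      (show ω ∈ {ω : ℕ → α | ∀ k, 0 < k → k ≤ 0 + n → ω k ∉ A} from fun k hk _ => h k hk)]
    simp

instance isMarkovKernel_pow [IsMarkovKernel κ] (n : ℕ) : IsMarkovKernel (κ ^ n) := by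
  induction n with
  | zero => exact inferInstanceAs (IsMarkovKernel Kernel.id)
  | succ n ih =>
    rw [pow_succ]
    exact inferInstanceAs (IsMarkovKernel ((κ ^ n) ∘ₖ κ))

theorem le_pow_succ_apply [IsMarkovKernel κ] {A : Set α} (hA : MeasurableSet A) {ε : ℝ≥0∞}
    (hε : ∀ x, ε ≤ κ x A) (n : ℕ) (x : α) : ε ≤ (κ ^ (n + 1)) x A := by
  rw [Kernel.pow_succ_apply_eq_lintegral κ n x hA]
  calc ε = ∫⁻ _, ε ∂((κ ^ n) x) := by simp
    _ ≤ _ := lintegral_mono fun y => hε y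

variable [IsMarkovKernel κ]

instance (x : α) : IsProbabilityMeasure (chainLaw κ x) := by
  unfold chainLaw
  infer_instance

/-- The Markov property of the chain at time `n`, for events about the first `n + 1` states. -/
theorem chainLaw_inter_succ (x : α) (n : ℕ) {C : Set ((i : Finset.Iic n) → α)}
    (hC : MeasurableSet C) {B : Set α} (hB : MeasurableSet B) :
    chainLaw κ x {ω | (fun i : Finset.Iic n => ω i) ∈ C ∧ ω (n + 1) ∈ B} =
      ∫⁻ ω in {ω | (fun i : Finset.Iic n => ω i) ∈ C}, κ (ω n) B ∂(chainLaw κ x) := by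
  have hr : Measurable (Preorder.frestrictLe (π := fun _ : ℕ => α) n) :=
    Preorder.measurable_frestrictLe n
  have hκ : Measurable fun h : (i : Finset.Iic n) → α => κ (h ⟨n, Finset.mem_Iic.2 le_rfl⟩) B :=
    (Kernel.measurable_coe κ hB).comp (measurable_pi_apply _)
  -- Evaluate on `C ×ˢ B` the joint law of the path up to time `n` and of the next state.
  have h := congrArg (fun μ => μ (C ×ˢ B))
    (Kernel.partialTraj_compProd_eq_map_traj (X := fun _ : ℕ => α)
      (κ := fun n => κ.comap (fun h : (i : Finset.Iic n) → α => h ⟨n, Finset.mem_Iic.2 le_rfl⟩)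
        (measurable_pi_apply _)) (a := 0) (zero_le (a := n)) (x₀ := fun _ => x))
  beta_reduce at h
  rw [Measure.compProd_apply_prod hC hB,
    Measure.map_apply (hr.prodMk (measurable_pi_apply _)) (hC.prod hB),
    ← Kernel.traj_map_frestrictLe_apply, setLIntegral_map hC (by simpa using hκ) hr] at h
  exact h.symm

/-- By the Markov property, each further step avoids `A` with probability at most `1 - ε`,
whatever the past. -/
theorem chainLaw_avoid_le {A : Set α} (hA : MeasurableSet A) {ε : ℝ≥0∞}
    (hε : ∀ x, ε ≤ κ x A) (x : α) (m n : ℕ) :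
    chainLaw κ x {ω | ∀ k, m < k → k ≤ m + n → ω k ∉ A} ≤ (1 - ε) ^ n := by
  induction n with
  | zero => simpa using prob_le_one
  | succ n ih =>
    -- The event that the first `m + n + 1` states avoid `A` after time `m`.
    let C : Set ((i : Finset.Iic (m + n)) → α) := {h | ∀ i : Finset.Iic (m + n), m < (i : ℕ) → h i ∉ A}
    have hC : MeasurableSet C := by
      simp only [C, Set.ofPred_forall]
      exact .iInter fun i => .iInter fun _ => (measurable_pi_apply i hA).compl
    have hset : {ω : ℕ → α | ∀ k, m < k → k ≤ m + (n + 1) → ω k ∉ A} =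
        {ω | (fun i : Finset.Iic (m + n) => ω i) ∈ C ∧ ω (m + n + 1) ∈ Aᶜ} := by
      ext ω
      simp only [Set.mem_ofPred_eq, C, Set.mem_compl_iff, Subtype.forall, Finset.mem_Iic]
      refine ⟨fun h => ⟨fun k hk hm => h k hm (by lia), h _ (by lia) (by lia)⟩,
        fun h k hm hk => ?_⟩
      rcases Nat.lt_or_ge (m + n) k with hlt | hle
      · obtain rfl : k = m + n + 1 := by lia
        exact h.2
      · exact h.1 k hle hm
    have hset' : {ω : ℕ → α | (fun i : Finset.Iic (m + n) => ω i) ∈ C} =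
        {ω | ∀ k, m < k → k ≤ m + n → ω k ∉ A} := by
      ext ω
      simp only [Set.mem_ofPred_eq, C, Subtype.forall, Finset.mem_Iic]
      exact ⟨fun h k hm hk => h k hk hm, fun h k hk hm => h k hm hk⟩
    rw [hset, chainLaw_inter_succ x (m + n) hC hA.compl, hset']
    calc _ ≤ ∫⁻ _ in {ω : ℕ → α | ∀ k, m < k → k ≤ m + n → ω k ∉ A}, (1 - ε) ∂(chainLaw κ x) :=
          lintegral_mono fun ω => by
            rw [prob_compl_eq_one_sub hA]
            exact tsub_le_tsub_left (hε _) _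
      _ = (1 - ε) * chainLaw κ x {ω | ∀ k, m < k → k ≤ m + n → ω k ∉ A} := by simp
      _ ≤ (1 - ε) * (1 - ε) ^ n := by gcongr
      _ = (1 - ε) ^ (n + 1) := by rw [pow_succ']

theorem ae_frequently_mem {A : Set α} (hA : MeasurableSet A) {ε : ℝ≥0∞} (h0 : 0 < ε)
    (hε : ∀ x, ε ≤ κ x A) (x : α) : ∀ᵐ ω ∂(chainLaw κ x), ∃ᶠ n in atTop, ω n ∈ A := by
  have hlt : 1 - ε < 1 := ENNReal.sub_lt_self ENNReal.one_ne_top one_ne_zero h0.ne'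
  have key : ∀ m : ℕ, ∀ᵐ ω ∂(chainLaw κ x), ∃ k, m < k ∧ ω k ∈ A := by
    intro m
    rw [ae_iff]
    refine le_antisymm (ge_of_tendsto' (ENNReal.tendsto_pow_atTop_nhds_zero_of_lt_one hlt)
      fun n => ?_) bot_le
    refine (measure_mono fun ω hω => ?_).trans (chainLaw_avoid_le hA hε x m n)
    simp only [Set.mem_ofPred_eq, not_exists, not_and] at hω
    exact fun k hm _ => hω k hm
  filter_upwards [ae_all_iff.2 key] with ω hω
  exact frequently_atTop'.2 hω

theorem lintegral_returnTime_le {A : Set α} (hA : MeasurableSet A) {ε : ℝ≥0∞}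
    (hε : ∀ x, ε ≤ κ x A) (x : α) : ∫⁻ ω, returnTime A ω ∂(chainLaw κ x) ≤ (1 - (1 - ε))⁻¹ := by
  have hm : ∀ n, MeasurableSet {ω : ℕ → α | ∀ k, 0 < k → k ≤ 0 + n → ω k ∉ A} := by
    intro n
    simp only [Set.ofPred_forall]
    exact .iInter fun k => .iInter fun _ => .iInter fun _ => (measurable_pi_apply k hA).compl
  calc _ ≤ ∫⁻ ω, ∑' n : ℕ, {ω : ℕ → α | ∀ k, 0 < k → k ≤ 0 + n → ω k ∉ A}.indicator 1 ω
        ∂(chainLaw κ x) := lintegral_mono (returnTime_le_tsum A)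
    _ = ∑' n : ℕ, chainLaw κ x {ω : ℕ → α | ∀ k, 0 < k → k ≤ 0 + n → ω k ∉ A} := by
        rw [lintegral_tsum fun n => (measurable_one.indicator (hm n)).aemeasurable]
        exact tsum_congr fun n => lintegral_indicator_one (hm n)
    _ ≤ ∑' n : ℕ, (1 - ε) ^ n := ENNReal.tsum_le_tsum fun n => chainLaw_avoid_le hA hε x 0 n
    _ = (1 - (1 - ε))⁻¹ := ENNReal.tsum_geometric _

/-- If every set of positive `φ`-measure is hit in one step with a probability bounded below
uniformly in the starting point, then the hitting times have geometric tails, which gives every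
form of positive recurrence. -/
theorem recurrent_of_uniform_hitting {φ : Measure α}
    (h : ∀ A, MeasurableSet A → 0 < φ A → ∃ ε : ℝ≥0∞, 0 < ε ∧ ∀ x, ε ≤ κ x A) :
    IsRecurrent φ κ ∧ VisitsInfinitelyOften φ κ ∧ HasFiniteMeanReturnTimes φ κ := by
  refine ⟨⟨⟨fun A hA hφ x => ?_⟩, fun A hA hφ x => ?_⟩, fun A hA hφ x => ?_, fun A hA hφ x => ?_⟩
  all_goals obtain ⟨ε, h0, hε⟩ := h A hA hφ
  · exact ⟨1, h0.trans_le (le_pow_succ_apply hA hε 0 x)⟩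
  · refine top_le_iff.1 ?_
    calc (∞ : ℝ≥0∞) = ∑' _ : ℕ, ε := (ENNReal.tsum_const_eq_top_of_ne_zero h0.ne').symm
      _ ≤ _ := ENNReal.tsum_le_tsum fun n => le_pow_succ_apply hA hε n x
  · exact ae_frequently_mem hA h0 hε x
  · refine (lintegral_returnTime_le hA hε x).trans_lt ?_
    rw [ENNReal.inv_lt_top]
    exact tsub_pos_of_lt (ENNReal.sub_lt_self ENNReal.one_ne_top one_ne_zero h0.ne')

end UniformHitting

/-! ### Product measures with densities -/

/-- A product of measures with integrable densities has the product of the densities as density. -/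
theorem pi_withDensity_ofReal {ι : Type*} [Fintype ι] {f : ι → ℝ → ℝ}
    (hf : ∀ i, Integrable (f i)) (h0 : ∀ i t, 0 ≤ f i t) :
    Measure.pi (fun i => (volume : Measure ℝ).withDensity fun t => ENNReal.ofReal (f i t)) =
      (volume : Measure (ι → ℝ)).withDensity fun x => ENNReal.ofReal (∏ i, f i (x i)) := by
  have : ∀ i, IsFiniteMeasure ((volume : Measure ℝ).withDensity fun t => ENNReal.ofReal (f i t)) :=
    fun i => isFiniteMeasure_withDensity_ofReal (hf i).2
  refine Measure.pi_eq fun s hs => ?_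
  have hg : ∀ i, Integrable ((s i).indicator (f i)) := fun i => (hf i).indicator (hs i)
  have hg0 : ∀ i t, 0 ≤ (s i).indicator (f i) t := fun i =>
    Set.indicator_nonneg fun t _ => h0 i t
  have hind : (Set.univ.pi s).indicator (fun x => ENNReal.ofReal (∏ i, f i (x i))) =
      fun x => ENNReal.ofReal (∏ i, (s i).indicator (f i) (x i)) := by
    funext x
    by_cases hx : x ∈ Set.univ.pi s
    · rw [Set.indicator_of_mem hx]
      congr 1
      exact Finset.prod_congr rfl fun i _ => (Set.indicator_of_mem (hx i trivial) _).symm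
    · rw [Set.indicator_of_notMem hx]
      obtain ⟨i, hi⟩ : ∃ i, x i ∉ s i := by simpa [Set.mem_pi] using hx
      rw [Finset.prod_eq_zero (Finset.mem_univ i) (Set.indicator_of_notMem hi _),
        ENNReal.ofReal_zero]
  rw [withDensity_apply _ (.univ_pi hs), ← lintegral_indicator (.univ_pi hs), hind, volume_pi,
    ← ofReal_integral_eq_lintegral_ofReal (Integrable.fintype_prod hg)
      (.of_forall fun x => Finset.prod_nonneg fun i _ => hg0 i _),
    integral_fintype_prod_eq_prod,
    ENNReal.ofReal_prod_of_nonneg fun i _ => integral_nonneg (hg0 i)]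
  refine Finset.prod_congr rfl fun i _ => ?_
  rw [withDensity_apply _ (hs i), integral_indicator (hs i),
    ofReal_integral_eq_lintegral_ofReal (hf i).integrableOn (.of_forall (h0 i))]

/-! ### The logistic distribution -/

theorem logisticDensity_pos {η : ℝ} (hη : 0 < η) (m t : ℝ) : 0 < logisticDensity m η t := by
  have := Real.cosh_pos ((t - m) / (2 * η))
  unfold logisticDensity
  positivity

theorem continuous_logisticDensity (m η : ℝ) : Continuous (logisticDensity m η) := by
  unfold logisticDensity
  exact continuous_const.mul ((continuous_const.div (Real.continuous_cosh.comp (by fun_prop))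
    fun t => (Real.cosh_pos _).ne').pow 2)

/-- The distribution function of the logistic distribution is the rescaled sigmoid. -/
theorem hasDerivAt_sigmoid_logisticDensity {η : ℝ} (hη : 0 < η) (m t : ℝ) :
    HasDerivAt (fun t => Real.sigmoid ((t - m) / η)) (logisticDensity m η t) t := by
  have h1 : HasDerivAt (fun t => (t - m) / η) (1 / η) t :=
    ((hasDerivAt_id t).sub_const m).div_const η
  refine ((Real.hasDerivAt_sigmoid ((t - m) / η)).comp t h1).congr_deriv ?_
  set u := (t - m) / (2 * η) with hu
  have hu2 : (t - m) / η = 2 * u := by rw [hu]; field_simp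
  have he : Real.exp (-(2 * u)) = Real.exp (-u) ^ 2 := by rw [← Real.exp_nat_mul]; ring_nf
  have hpos := Real.exp_pos (-u)
  have hinv : Real.exp u = (Real.exp (-u))⁻¹ := by rw [Real.exp_neg, inv_inv]
  rw [logisticDensity, ← hu, hu2, Real.sigmoid_def, he, Real.cosh_eq, hinv]
  field_simp
  ring

theorem tendsto_sigmoid_affine_atTop {η : ℝ} (hη : 0 < η) (m : ℝ) :
    Tendsto (fun t => Real.sigmoid ((t - m) / η)) atTop (nhds 1) :=
  Real.tendsto_sigmoid_atTop.comp
    ((tendsto_atTop_add_const_right _ (-m) tendsto_id).atTop_div_const hη)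

theorem tendsto_sigmoid_affine_atBot {η : ℝ} (hη : 0 < η) (m : ℝ) :
    Tendsto (fun t => Real.sigmoid ((t - m) / η)) atBot (nhds 0) :=
  Real.tendsto_sigmoid_atBot.comp
    ((tendsto_atBot_add_const_right _ (-m) tendsto_id).atBot_div_const hη)

theorem integrable_logisticDensity {η : ℝ} (hη : 0 < η) (m : ℝ) :
    Integrable (logisticDensity m η) := by
  refine integrable_of_intervalIntegral_norm_tendsto (l := atTop) (a := fun n : ℝ => -n) (b := id)
    (1 - 0) (fun n => ((continuous_logisticDensity m η).integrableOn_Icc).mono_set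
      Set.Ioc_subset_Icc_self) tendsto_neg_atTop_atBot tendsto_id ?_
  have : ∀ n : ℝ, ∫ t in (-n)..(id n), ‖logisticDensity m η t‖ =
      Real.sigmoid ((n - m) / η) - Real.sigmoid ((-n - m) / η) := fun n => by
    simp_rw [Real.norm_of_nonneg (logisticDensity_pos hη m _).le]
    exact intervalIntegral.integral_eq_sub_of_hasDerivAt
      (fun t _ => hasDerivAt_sigmoid_logisticDensity hη m t)
      ((continuous_logisticDensity m η).intervalIntegrable _ _)
  simp_rw [this]
  exact (tendsto_sigmoid_affine_atTop hη m).sub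
    ((tendsto_sigmoid_affine_atBot hη m).comp tendsto_neg_atTop_atBot)

theorem integral_logisticDensity {η : ℝ} (hη : 0 < η) (m : ℝ) :
    ∫ t, logisticDensity m η t = 1 := by
  rw [integral_of_hasDerivAt_of_tendsto (hasDerivAt_sigmoid_logisticDensity hη m)
    (integrable_logisticDensity hη m) (tendsto_sigmoid_affine_atBot hη m)
    (tendsto_sigmoid_affine_atTop hη m), sub_zero]

theorem isProbabilityMeasure_logisticMeasure {η : ℝ} (hη : 0 < η) (m : ℝ) :
    IsProbabilityMeasure (logisticMeasure m η) := by
  refine ⟨?_⟩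
  rw [logisticMeasure, withDensity_apply _ .univ, setLIntegral_univ,
    ← ofReal_integral_eq_lintegral_ofReal (integrable_logisticDensity hη m)
      (.of_forall fun t => (logisticDensity_pos hη m t).le), integral_logisticDensity hη,
    ENNReal.ofReal_one]

/-! ### The noising kernel and the joint distribution -/

variable {d : ℕ} {Θ : Fin d → Finset ℝ}

theorem isMarkovKernel_noiseKernel {η : ℝ} (hη : 0 < η) :
    IsMarkovKernel (noiseKernel η : Kernel (Dom Θ) (Fin d → ℝ)) := by
  refine ⟨fun θ => ?_⟩
  have := fun i => isProbabilityMeasure_logisticMeasure hη (θ i : ℝ)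
  exact inferInstanceAs (IsProbabilityMeasure (Measure.pi fun i => logisticMeasure (θ i : ℝ) η))

theorem noiseKernel_apply {η : ℝ} (hη : 0 < η) (θ : Dom Θ) :
    noiseKernel η θ = volume.withDensity fun a => ENNReal.ofReal (noiseDensity η θ a) :=
  pi_withDensity_ofReal (fun i => integrable_logisticDensity hη (θ i : ℝ))
    fun _ t => (logisticDensity_pos hη _ t).le

theorem noiseDensity_pos {η : ℝ} (hη : 0 < η) (θ : Dom Θ) (a : Fin d → ℝ) :
    0 < noiseDensity η θ a :=
  Finset.prod_pos fun _ _ => logisticDensity_pos hη _ _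

theorem measurable_noiseDensity (η : ℝ) (θ : Dom Θ) : Measurable (noiseDensity η θ) :=
  Finset.measurable_fun_prod _ fun i _ =>
    (continuous_logisticDensity _ η).measurable.comp (measurable_pi_apply i)

theorem lintegral_noiseKernel {η : ℝ} (hη : 0 < η) (θ : Dom Θ) {f : (Fin d → ℝ) → ℝ≥0∞}
    (hf : Measurable f) :
    ∫⁻ a, f a ∂(noiseKernel η θ) = ∫⁻ a, ENNReal.ofReal (noiseDensity η θ a) * f a := by
  rw [noiseKernel_apply hη, lintegral_withDensity_eq_lintegral_mul _
    (measurable_noiseDensity η θ).ennreal_ofReal hf]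
  rfl

theorem exp_coupling (η : ℝ) (θ : Dom Θ) (a : Fin d → ℝ) :
    Real.exp (coupling η θ a) = ∏ i, (1 / Real.cosh ((a i - (θ i : ℝ)) / (2 * η))) ^ 2 := by
  rw [coupling, Real.exp_sum]
  refine Finset.prod_congr rfl fun i _ => ?_
  have h := Real.cosh_pos ((a i - (θ i : ℝ)) / (2 * η))
  rw [neg_mul, Real.exp_neg, mul_comm, Real.exp_mul, Real.exp_log h, one_div, inv_pow]
  norm_cast

theorem noiseDensity_eq (η : ℝ) (θ : Dom Θ) (a : Fin d → ℝ) :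
    noiseDensity η θ a = Real.exp (coupling η θ a) / (4 * η) ^ d := by
  simp only [noiseDensity, logisticDensity, Finset.prod_mul_distrib, exp_coupling,
    Finset.prod_const, Finset.card_univ, Fintype.card_fin]
  rw [div_pow, one_pow, one_div_mul_eq_div]

theorem jointDensity_eq (U : Dom Θ → ℝ) (η : ℝ) (θ : Dom Θ) (a : Fin d → ℝ) :
    jointDensity U η (θ, a) = targetProb U θ * noiseDensity η θ a := by
  rw [jointDensity, targetProb, noiseDensity_eq, Real.exp_add, div_mul_div_comm,
    mul_comm (partitionZ U)]

theorem measurable_jointDensity (U : Dom Θ → ℝ) (η : ℝ) : Measurable (jointDensity U η) :=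
  measurable_from_prod_countable_right fun θ => by
    simp_rw [jointDensity_eq]
    exact (measurable_noiseDensity η θ).const_mul _

theorem nonempty_dom (hΘ : ∀ i, (Θ i).Nonempty) : Nonempty (Dom Θ) :=
  ⟨fun i => ⟨(hΘ i).choose, (hΘ i).choose_spec⟩⟩

variable [Nonempty (Dom Θ)]

theorem partitionZ_pos (U : Dom Θ → ℝ) : 0 < partitionZ U :=
  Finset.sum_pos (fun _ _ => Real.exp_pos _) Finset.univ_nonempty

theorem targetProb_pos (U : Dom Θ → ℝ) (θ : Dom Θ) : 0 < targetProb U θ :=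
  div_pos (Real.exp_pos _) (partitionZ_pos U)

theorem sum_targetProb (U : Dom Θ → ℝ) : ∑ θ, targetProb U θ = 1 := by
  simp only [targetProb, ← Finset.sum_div]
  exact div_self (partitionZ_pos U).ne'

theorem jointDensity_pos (U : Dom Θ → ℝ) {η : ℝ} (hη : 0 < η) (θ : Dom Θ) (a : Fin d → ℝ) :
    0 < jointDensity U η (θ, a) := by
  rw [jointDensity_eq]
  exact mul_pos (targetProb_pos U θ) (noiseDensity_pos hη θ a)

omit [Nonempty (Dom Θ)] in
theorem lintegral_jointMeasure (U : Dom Θ → ℝ) (η : ℝ) {f : Dom Θ × (Fin d → ℝ) → ℝ≥0∞}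
    (hf : Measurable f) :
    ∫⁻ x, f x ∂(jointMeasure U η) =
      ∑ θ, ∫⁻ a, ENNReal.ofReal (jointDensity U η (θ, a)) * f (θ, a) := by
  rw [jointMeasure, lintegral_withDensity_eq_lintegral_mul _
    (measurable_jointDensity U η).ennreal_ofReal hf, lintegral_prod _
    ((measurable_jointDensity U η).ennreal_ofReal.mul hf).aemeasurable, lintegral_count, tsum_fintype]
  rfl

/-- Under the joint distribution `θ` has law `π`, and `a` is obtained from `θ` by noising. -/
theorem lintegral_jointMeasure_eq_noise (U : Dom Θ → ℝ) {η : ℝ} (hη : 0 < η)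
    {f : Dom Θ × (Fin d → ℝ) → ℝ≥0∞} (hf : Measurable f) :
    ∫⁻ x, f x ∂(jointMeasure U η) =
      ∑ θ, ENNReal.ofReal (targetProb U θ) * ∫⁻ a, f (θ, a) ∂(noiseKernel η θ) := by
  rw [lintegral_jointMeasure U η hf]
  refine Finset.sum_congr rfl fun θ _ => ?_
  have hfθ : Measurable fun a => f (θ, a) := hf.comp measurable_prodMk_left
  rw [lintegral_noiseKernel hη θ hfθ, ← lintegral_const_mul' _ _ ENNReal.ofReal_ne_top]
  refine lintegral_congr fun a => ?_
  rw [jointDensity_eq, ENNReal.ofReal_mul (targetProb_pos U θ).le, mul_assoc]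

theorem isProbabilityMeasure_jointMeasure (U : Dom Θ → ℝ) {η : ℝ} (hη : 0 < η) :
    IsProbabilityMeasure (jointMeasure U η) := by
  have := isMarkovKernel_noiseKernel (Θ := Θ) hη
  refine ⟨?_⟩
  rw [← lintegral_one, lintegral_jointMeasure_eq_noise U hη measurable_const]
  simp only [lintegral_one, measure_univ, mul_one]
  rw [← ENNReal.ofReal_sum_of_nonneg fun θ _ => (targetProb_pos U θ).le, sum_targetProb,
    ENNReal.ofReal_one]

end HiSS

namespace HiSS

variable {d : ℕ} {Θ : Fin d → Finset ℝ}

/-! ### The Metropolis-Hastings step -/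

theorem denoiseProb_pos (η : ℝ) (a : Fin d → ℝ) (θ : Dom Θ) : 0 < denoiseProb η a θ :=
  Finset.prod_pos fun i _ =>
    div_pos (Real.exp_pos _) (Finset.sum_pos (fun _ _ => Real.exp_pos _) ⟨θ i, Finset.mem_univ _⟩)

theorem sum_denoiseProb [Nonempty (Dom Θ)] (η : ℝ) (a : Fin d → ℝ) :
    ∑ θ : Dom Θ, denoiseProb η a θ = 1 := by
  classical
  let w : (i : Fin d) → Θ i → ℝ := fun i t =>
    Real.exp (-2 * Real.log (Real.cosh ((a i - (t : ℝ)) / (2 * η))))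
  have h := Finset.prod_univ_sum (fun i => (Finset.univ : Finset (Θ i)))
    fun i t => w i t / ∑ s, w i s
  rw [Fintype.piFinset_univ] at h
  refine h.symm.trans (Finset.prod_eq_one fun i _ => ?_)
  rw [← Finset.sum_div]
  exact div_self (Finset.sum_pos (fun _ _ => Real.exp_pos _)
    ⟨Classical.arbitrary (Dom Θ) i, Finset.mem_univ _⟩).ne'

theorem acceptProb_le_one (U : Dom Θ → ℝ) (η : ℝ) (a : Fin d → ℝ) (θ θ' : Dom Θ) :
    acceptProb U η a θ θ' ≤ 1 := min_le_left _ _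

variable [Nonempty (Dom Θ)]

theorem acceptProb_pos (U : Dom Θ → ℝ) {η : ℝ} (hη : 0 < η) (a : Fin d → ℝ) (θ θ' : Dom Θ) :
    0 < acceptProb U η a θ θ' := by
  have h : ∀ ξ ζ : Dom Θ, 0 < targetProb U ξ * noiseDensity η ξ a * denoiseProb η a ζ :=
    fun ξ ζ => mul_pos (mul_pos (targetProb_pos U ξ) (noiseDensity_pos hη ξ a))
      (denoiseProb_pos η a ζ)
  exact lt_min one_pos (div_pos (h _ _) (h _ _))

/-- Given `a`, the Metropolis-Hastings step reaches every state from every state, since the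
denoising proposal charges every state and no proposal is rejected with certainty. -/
theorem mwgProb_pos (U : Dom Θ → ℝ) {η : ℝ} (hη : 0 < η) (a : Fin d → ℝ) (θ θ' : Dom Θ) :
    0 < mwgProb U η a θ θ' := by
  refine add_pos_of_pos_of_nonneg
    (mul_pos (denoiseProb_pos η a θ') (acceptProb_pos U hη a θ θ')) ?_
  split_ifs
  · exact Finset.sum_nonneg fun ξ _ =>
      mul_nonneg (denoiseProb_pos η a ξ).le (sub_nonneg.2 (acceptProb_le_one U η a θ ξ))
  · exact le_rfl

theorem sum_mwgProb (U : Dom Θ → ℝ) (η : ℝ) (a : Fin d → ℝ) (θ : Dom Θ) :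
    ∑ θ', mwgProb U η a θ θ' = 1 := by
  simp only [mwgProb, Finset.sum_add_distrib, Finset.sum_ite_eq', Finset.mem_univ, if_true]
  rw [← Finset.sum_add_distrib]
  refine Eq.trans ?_ (sum_denoiseProb (Θ := Θ) η a)
  exact Finset.sum_congr rfl fun ξ _ => by ring

/-- Detailed balance of the Metropolis-Hastings step: off the diagonal both sides equal
`min (p(θ, a) q(θ' | a)) (p(θ', a) q(θ | a))`, where `q` is the denoising proposal. -/
theorem jointDensity_mul_mwgProb (U : Dom Θ → ℝ) {η : ℝ} (hη : 0 < η) (a : Fin d → ℝ)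
    (θ θ' : Dom Θ) :
    jointDensity U η (θ, a) * mwgProb U η a θ θ' =
      jointDensity U η (θ', a) * mwgProb U η a θ' θ := by
  rcases eq_or_ne θ' θ with rfl | hne
  · rfl
  have key : ∀ ξ ζ : Dom Θ, jointDensity U η (ξ, a) * (denoiseProb η a ζ * acceptProb U η a ξ ζ) =
      min (jointDensity U η (ξ, a) * denoiseProb η a ζ)
        (jointDensity U η (ζ, a) * denoiseProb η a ξ) := fun ξ ζ => by
    have hpos := mul_pos (jointDensity_pos U hη ξ a) (denoiseProb_pos η a ζ)
    rw [acceptProb, ← jointDensity_eq, ← jointDensity_eq, ← mul_assoc,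
      mul_min_of_nonneg _ _ hpos.le, mul_one, mul_div_cancel₀ _ hpos.ne']
  rw [mwgProb, mwgProb, if_neg hne, if_neg hne.symm, add_zero, add_zero, key, key, min_comm]

theorem isMarkovKernel_mwgKernel (U : Dom Θ → ℝ) {η : ℝ} (hη : 0 < η) :
    IsMarkovKernel (mwgKernel U η) := by
  refine ⟨fun x => ⟨?_⟩⟩
  change (∑ θ', ENNReal.ofReal (mwgProb U η x.2 x.1 θ') • Measure.dirac θ') Set.univ = 1
  simp only [Measure.coe_finsetSum, Finset.sum_apply, Measure.smul_apply, measure_univ,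
    smul_eq_mul, mul_one]
  rw [← ENNReal.ofReal_sum_of_nonneg fun θ' _ => (mwgProb_pos U hη _ _ θ').le, sum_mwgProb,
    ENNReal.ofReal_one]

omit [Nonempty (Dom Θ)] in
theorem sum_smul_dirac_singleton (c : Dom Θ → ℝ≥0∞) (θ : Dom Θ) :
    (∑ ξ, c ξ • Measure.dirac ξ : Measure (Dom Θ)) {θ} = c θ := by
  classical
  simp [Set.indicator_apply]

omit [Nonempty (Dom Θ)] in
theorem mwgKernel_singleton (U : Dom Θ → ℝ) (η : ℝ) (x : Dom Θ × (Fin d → ℝ)) (θ' : Dom Θ) :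
    mwgKernel U η x {θ'} = ENNReal.ofReal (mwgProb U η x.2 x.1 θ') :=
  sum_smul_dirac_singleton _ θ'

/-! ### Integrals against the steps of a sweep -/

omit [Nonempty (Dom Θ)] in
theorem isMarkovKernel_noiseStep {η : ℝ} (hη : 0 < η) :
    IsMarkovKernel (noiseStep η : Kernel (Dom Θ × (Fin d → ℝ)) _) := by
  have := isMarkovKernel_noiseKernel (Θ := Θ) hη
  unfold noiseStep
  infer_instance

omit [Nonempty (Dom Θ)] in
theorem lintegral_noiseStep {η : ℝ} (hη : 0 < η) (x : Dom Θ × (Fin d → ℝ))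
    {g : Dom Θ × (Fin d → ℝ) → ℝ≥0∞} (hg : Measurable g) :
    ∫⁻ y, g y ∂(noiseStep η x) = ∫⁻ a, g (x.1, a) ∂(noiseKernel η x.1) := by
  have := isMarkovKernel_noiseKernel (Θ := Θ) hη
  rw [noiseStep, Kernel.lintegral_deterministic_prod _ _ _ hg, Kernel.comap_apply]

omit [Nonempty (Dom Θ)] in
instance (Ψ : Kernel (Dom Θ × (Fin d → ℝ)) (Dom Θ)) [IsMarkovKernel Ψ] :
    IsMarkovKernel (updateDiscrete Ψ) := by
  unfold updateDiscrete
  infer_instance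

omit [Nonempty (Dom Θ)] in
theorem lintegral_updateDiscrete (Ψ : Kernel (Dom Θ × (Fin d → ℝ)) (Dom Θ)) [IsMarkovKernel Ψ]
    (x : Dom Θ × (Fin d → ℝ)) {g : Dom Θ × (Fin d → ℝ) → ℝ≥0∞} (hg : Measurable g) :
    ∫⁻ y, g y ∂(updateDiscrete Ψ x) = ∑ ξ, g (ξ, x.2) * Ψ x {ξ} := by
  rw [updateDiscrete, Kernel.lintegral_prod_deterministic _ _ _ hg, lintegral_fintype]

theorem isMarkovKernel_sweep (U : Dom Θ → ℝ) {η : ℝ} (hη : 0 < η)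
    (Φ : Kernel (Dom Θ × (Fin d → ℝ)) (Dom Θ)) [IsMarkovKernel Φ] (L : ℕ) :
    IsMarkovKernel (sweep U η Φ L) := by
  have := isMarkovKernel_mwgKernel U hη
  have := isMarkovKernel_noiseStep (Θ := Θ) hη
  unfold sweep
  infer_instance

/-! ### Invariance of the joint distribution -/

theorem invariant_noiseStep (U : Dom Θ → ℝ) {η : ℝ} (hη : 0 < η) :
    Kernel.Invariant (noiseStep η) (jointMeasure U η) := by
  have := isMarkovKernel_noiseKernel (Θ := Θ) hη
  ext A hA
  have hind : Measurable (A.indicator (1 : Dom Θ × (Fin d → ℝ) → ℝ≥0∞)) :=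
    measurable_one.indicator hA
  rw [Measure.bind_apply hA (Kernel.aemeasurable _),
    lintegral_jointMeasure_eq_noise U hη (Kernel.measurable_coe _ hA), ← lintegral_indicator_one hA,
    lintegral_jointMeasure_eq_noise U hη hind]
  refine Finset.sum_congr rfl fun θ _ => ?_
  simp_rw [← lintegral_indicator_one hA, lintegral_noiseStep hη _ hind, lintegral_const,
    measure_univ, mul_one]

omit [Nonempty (Dom Θ)] in
/-- A kernel on `Θ` that, for every value of `a`, preserves the weights `p(·, a)` yields an update
that preserves `p`. -/
theorem invariant_updateDiscrete (U : Dom Θ → ℝ) (η : ℝ)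
    (Ψ : Kernel (Dom Θ × (Fin d → ℝ)) (Dom Θ)) [IsMarkovKernel Ψ]
    (h : ∀ a ξ, ∑ θ, ENNReal.ofReal (jointDensity U η (θ, a)) * Ψ (θ, a) {ξ} =
      ENNReal.ofReal (jointDensity U η (ξ, a))) :
    Kernel.Invariant (updateDiscrete Ψ) (jointMeasure U η) := by
  ext A hA
  have hind : Measurable (A.indicator (1 : Dom Θ × (Fin d → ℝ) → ℝ≥0∞)) :=
    measurable_one.indicator hA
  have hp : ∀ θ, Measurable fun a => ENNReal.ofReal (jointDensity U η (θ, a)) := fun θ =>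
    ((measurable_jointDensity U η).comp measurable_prodMk_left).ennreal_ofReal
  have hA' : ∀ ξ : Dom Θ, Measurable fun a => A.indicator (1 : Dom Θ × (Fin d → ℝ) → ℝ≥0∞) (ξ, a) := fun ξ =>
    hind.comp measurable_prodMk_left
  have hΨ : ∀ θ ξ, Measurable fun a => Ψ (θ, a) {ξ} := fun θ ξ =>
    (Kernel.measurable_coe Ψ (measurableSet_singleton ξ)).comp measurable_prodMk_left
  rw [Measure.bind_apply hA (Kernel.aemeasurable _),
    lintegral_jointMeasure U η (Kernel.measurable_coe _ hA), ← lintegral_indicator_one hA,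
    lintegral_jointMeasure U η hind]
  simp_rw [← lintegral_indicator_one hA, lintegral_updateDiscrete Ψ _ hind]
  have hl : ∀ θ, Measurable fun a => ENNReal.ofReal (jointDensity U η (θ, a)) *
      ∑ ξ, A.indicator (1 : Dom Θ × (Fin d → ℝ) → ℝ≥0∞) (ξ, a) * Ψ (θ, a) {ξ} := fun θ =>
    (hp θ).mul (Finset.measurable_fun_sum _ fun ξ _ => (hA' ξ).mul (hΨ θ ξ))
  have hr : ∀ θ, Measurable fun a => ENNReal.ofReal (jointDensity U η (θ, a)) *
      A.indicator (1 : Dom Θ × (Fin d → ℝ) → ℝ≥0∞) (θ, a) := fun θ => (hp θ).mul (hA' θ)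
  rw [← lintegral_finsetSum _ fun θ _ => hl θ, ← lintegral_finsetSum _ fun θ _ => hr θ]
  refine lintegral_congr fun a => ?_
  simp_rw [Finset.mul_sum]
  rw [Finset.sum_comm]
  refine Finset.sum_congr rfl fun ξ _ => ?_
  rw [← h a ξ, Finset.sum_mul]
  exact Finset.sum_congr rfl fun θ _ => by ring

theorem jointDensity_balance_mwgKernel (U : Dom Θ → ℝ) {η : ℝ} (hη : 0 < η) (a : Fin d → ℝ)
    (ξ : Dom Θ) :
    ∑ θ, ENNReal.ofReal (jointDensity U η (θ, a)) * mwgKernel U η (θ, a) {ξ} =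
      ENNReal.ofReal (jointDensity U η (ξ, a)) := by
  simp_rw [mwgKernel_singleton]
  calc _ = ∑ θ, ENNReal.ofReal (jointDensity U η (ξ, a) * mwgProb U η a ξ θ) :=
        Finset.sum_congr rfl fun θ _ => by
          rw [← ENNReal.ofReal_mul (jointDensity_pos U hη θ a).le, jointDensity_mul_mwgProb U hη]
    _ = _ := by
        rw [← ENNReal.ofReal_sum_of_nonneg fun θ _ =>
            (mul_pos (jointDensity_pos U hη ξ a) (mwgProb_pos U hη a ξ θ)).le,
          ← Finset.mul_sum, sum_mwgProb, mul_one]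

/-- Invariance of `p(· | a)` under the inner sampler, multiplied by the marginal density of `a`. -/
theorem jointDensity_balance_of_invariant (U : Dom Θ → ℝ) {η : ℝ} (hη : 0 < η)
    (Φ : Kernel (Dom Θ × (Fin d → ℝ)) (Dom Θ)) (a : Fin d → ℝ)
    (hΦ : Kernel.Invariant (Φ.sectL a) (condMeasure U η a)) (ξ : Dom Θ) :
    ∑ θ, ENNReal.ofReal (jointDensity U η (θ, a)) * Φ (θ, a) {ξ} =
      ENNReal.ofReal (jointDensity U η (ξ, a)) := by
  set S := ∑ θ, Real.exp (U θ + coupling η θ a) with hS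
  have hSpos : 0 < S := Finset.sum_pos (fun _ _ => Real.exp_pos _) Finset.univ_nonempty
  -- `m` is the marginal density of `a`.
  set m := S / ((4 * η) ^ d * partitionZ U) with hm
  have hmpos : 0 < m := div_pos hSpos (mul_pos (by positivity) (partitionZ_pos U))
  have hj : ∀ θ, jointDensity U η (θ, a) = m * condProb U η a θ := fun θ => by
    rw [jointDensity, condProb, ← hS, hm, div_mul_div_comm, mul_comm S,
      mul_div_mul_right _ _ hSpos.ne']
  have h := congrArg (fun μ : Measure (Dom Θ) => μ {ξ}) hΦ.def
  beta_reduce at h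
  rw [Measure.bind_apply (measurableSet_singleton ξ) (Kernel.aemeasurable _), condMeasure,
    sum_smul_dirac_singleton, lintegral_finsetSum_measure] at h
  simp only [lintegral_smul_measure, lintegral_dirac, Kernel.sectL_apply, smul_eq_mul] at h
  simp_rw [hj, ENNReal.ofReal_mul hmpos.le, mul_assoc]
  rw [← Finset.mul_sum, h]

omit [Nonempty (Dom Θ)] in
theorem invariant_pow {α : Type*} [MeasurableSpace α] {κ : Kernel α α} {μ : Measure α}
    (h : Kernel.Invariant κ μ) (n : ℕ) : Kernel.Invariant (κ ^ n) μ := by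
  induction n with
  | zero => exact Measure.bind_dirac
  | succ n ih => exact ih.comp h

theorem invariant_hissKernel (U : Dom Θ → ℝ) {η : ℝ} (hη : 0 < η)
    (Φ : Kernel (Dom Θ × (Fin d → ℝ)) (Dom Θ)) [IsMarkovKernel Φ]
    (hΦ : ∀ a : Fin d → ℝ, Kernel.Invariant (Φ.sectL a) (condMeasure U η a)) (L G : ℕ) :
    Kernel.Invariant (hissKernel U η Φ L G) (jointMeasure U η) := by
  have := isMarkovKernel_mwgKernel U hη
  have hmwg := invariant_updateDiscrete U η _ (jointDensity_balance_mwgKernel U hη)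
  have hinner := invariant_updateDiscrete U η Φ
    fun a => jointDensity_balance_of_invariant U hη Φ a (hΦ a)
  exact invariant_pow ((invariant_pow hinner L).comp (hmwg.comp (invariant_noiseStep U hη))) G

/-! ### Uniform positivity of the sweep -/

omit [Nonempty (Dom Θ)] in
theorem exists_pow_updateDiscrete_pos (Φ : Kernel (Dom Θ × (Fin d → ℝ)) (Dom Θ)) [IsMarkovKernel Φ]
    (a : Fin d → ℝ) (hΦ : ∀ θ', ∃ θ, 0 < Φ (θ, a) {θ'}) (L : ℕ) (θ' : Dom Θ) :
    ∃ θ, 0 < ((updateDiscrete Φ) ^ L) (θ, a) {(θ', a)} := by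
  induction L generalizing θ' with
  | zero =>
    refine ⟨θ', ?_⟩
    change 0 < Measure.dirac (θ', a) {(θ', a)}
    simp
  | succ L ih =>
    obtain ⟨ζ, hζ⟩ := hΦ θ'
    obtain ⟨θ, hθ⟩ := ih ζ
    refine ⟨θ, ?_⟩
    have hstep : 0 < updateDiscrete Φ (ζ, a) {(θ', a)} := by
      have hind : Measurable (({(θ', a)} : Set (Dom Θ × (Fin d → ℝ))).indicator
          (1 : Dom Θ × (Fin d → ℝ) → ℝ≥0∞)) :=
        measurable_one.indicator (measurableSet_singleton _)
      rw [← lintegral_indicator_one (measurableSet_singleton _), lintegral_updateDiscrete Φ _ hind]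
      refine lt_of_lt_of_le ?_ (Finset.single_le_sum (fun _ _ => zero_le) (Finset.mem_univ θ'))
      simpa using hζ
    rw [Kernel.pow_succ_apply_eq_lintegral _ _ _ (measurableSet_singleton _)]
    refine lt_of_lt_of_le ?_ (setLIntegral_le_lintegral {(ζ, a)} _)
    rw [lintegral_singleton]
    exact ENNReal.mul_pos hstep.ne' hθ.ne'

theorem sweep_apply (U : Dom Θ → ℝ) {η : ℝ} (hη : 0 < η)
    (Φ : Kernel (Dom Θ × (Fin d → ℝ)) (Dom Θ)) (L : ℕ)
    (x : Dom Θ × (Fin d → ℝ)) {A : Set (Dom Θ × (Fin d → ℝ))} (hA : MeasurableSet A) :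
    sweep U η Φ L x A = ∫⁻ a, ∑ ξ, ((updateDiscrete Φ) ^ L) (ξ, a) A *
      ENNReal.ofReal (mwgProb U η a x.1 ξ) ∂(noiseKernel η x.1) := by
  have := isMarkovKernel_mwgKernel U hη
  have hm : Measurable fun y => ((updateDiscrete Φ) ^ L) y A := Kernel.measurable_coe _ hA
  rw [sweep, Kernel.comp_apply' _ _ _ hA, Kernel.lintegral_comp _ _ _ hm,
    lintegral_noiseStep hη _ hm.lintegral_kernel]
  simp_rw [lintegral_updateDiscrete _ _ hm, mwgKernel_singleton]

/-- The noise density and the Metropolis-Hastings probabilities are positive, and given `a` the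
inner sampler leaves no state unreachable; so a sweep from any starting point charges every set
that the joint distribution charges. -/
theorem sweep_apply_pos (U : Dom Θ → ℝ) {η : ℝ} (hη : 0 < η)
    (Φ : Kernel (Dom Θ × (Fin d → ℝ)) (Dom Θ)) [IsMarkovKernel Φ]
    (hΦ : ∀ (a : Fin d → ℝ) (θ' : Dom Θ), ∃ θ, 0 < Φ (θ, a) {θ'}) (L : ℕ)
    (x : Dom Θ × (Fin d → ℝ)) {A : Set (Dom Θ × (Fin d → ℝ))} (hA : MeasurableSet A)
    (hpA : 0 < jointMeasure U η A) : 0 < sweep U η Φ L x A := by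
  by_contra h0
  have h0 : sweep U η Φ L x A = 0 := le_antisymm (not_lt.1 h0) bot_le
  have hm : Measurable fun a => ∑ ξ, ((updateDiscrete Φ) ^ L) (ξ, a) A *
      ENNReal.ofReal (mwgProb U η a x.1 ξ) :=
    Finset.measurable_fun_sum _ fun ξ _ =>
      ((Kernel.measurable_coe _ hA).comp measurable_prodMk_left).mul
        ((measurable_mwgProb U η ξ).comp measurable_prodMk_left).ennreal_ofReal
  rw [sweep_apply U hη Φ L x hA, lintegral_noiseKernel hη _ hm] at h0
  replace h0 := (lintegral_eq_zero_iff
    ((measurable_noiseDensity η x.1).ennreal_ofReal.mul hm)).1 h0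
  have hae : ∀ᵐ a : Fin d → ℝ, ∀ θ' : Dom Θ, (θ', a) ∉ A := by
    filter_upwards [h0] with a ha θ' hθ'
    obtain ⟨ξ, hξ⟩ := exists_pow_updateDiscrete_pos Φ a (hΦ a) L θ'
    have hξA := hξ.trans_le (measure_mono (Set.singleton_subset_iff.2 hθ'))
    have hsum : (0 : ℝ≥0∞) < ∑ ξ, ((updateDiscrete Φ) ^ L) (ξ, a) A *
        ENNReal.ofReal (mwgProb U η a x.1 ξ) :=
      lt_of_lt_of_le (ENNReal.mul_pos hξA.ne' (ENNReal.ofReal_pos.2 (mwgProb_pos U hη a x.1 ξ)).ne')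
        (Finset.single_le_sum (f := fun ξ => ((updateDiscrete Φ) ^ L) (ξ, a) A *
          ENNReal.ofReal (mwgProb U η a x.1 ξ)) (fun _ _ => zero_le) (Finset.mem_univ ξ))
    exact (ENNReal.mul_pos (ENNReal.ofReal_pos.2 (noiseDensity_pos hη x.1 a)).ne' hsum.ne').ne' ha
  refine hpA.ne' ?_
  rw [← lintegral_indicator_one hA, lintegral_jointMeasure U η (measurable_one.indicator hA)]
  refine Finset.sum_eq_zero fun θ' _ => (lintegral_congr_ae ?_).trans lintegral_zero
  filter_upwards [hae] with a ha
  rw [Set.indicator_of_notMem (ha θ'), mul_zero]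

/-- The bound is uniform because the law of a sweep depends on its starting point only through the
discrete component, which takes finitely many values. -/
theorem exists_le_sweep_apply (U : Dom Θ → ℝ) {η : ℝ} (hη : 0 < η)
    (Φ : Kernel (Dom Θ × (Fin d → ℝ)) (Dom Θ)) [IsMarkovKernel Φ]
    (hΦ : ∀ (a : Fin d → ℝ) (θ' : Dom Θ), ∃ θ, 0 < Φ (θ, a) {θ'}) (L : ℕ)
    {A : Set (Dom Θ × (Fin d → ℝ))} (hA : MeasurableSet A) (hpA : 0 < jointMeasure U η A) :
    ∃ ε : ℝ≥0∞, 0 < ε ∧ ∀ x, ε ≤ sweep U η Φ L x A := by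
  obtain ⟨θ₀, h₀⟩ := Finite.exists_min fun θ : Dom Θ => sweep U η Φ L (θ, 0) A
  refine ⟨_, sweep_apply_pos U hη Φ hΦ L (θ₀, 0) hA hpA, fun x => (h₀ x.1).trans_eq ?_⟩
  rw [sweep_apply U hη Φ L _ hA, sweep_apply U hη Φ L _ hA]

end HiSS

theorem mainTheorem4 {d : ℕ} (Θ : Fin d → Finset ℝ) (hΘ : ∀ i, (Θ i).Nonempty)
    (U : HiSS.Dom Θ → ℝ) (η : ℝ) (hη : 0 < η)
    (Φ : Kernel (HiSS.Dom Θ × (Fin d → ℝ)) (HiSS.Dom Θ)) [IsMarkovKernel Φ]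
    (L G : ℕ) (hG : 1 ≤ G) :
    IsProbabilityMeasure (HiSS.jointMeasure U η) ∧
    ∃ _ : IsMarkovKernel (HiSS.hissKernel U η Φ L G),
      -- inner samplers that sample from the conditionals of the joint distribution
      ((∀ a : Fin d → ℝ, Kernel.Invariant (Φ.sectL a) (HiSS.condMeasure U η a)) →
        Kernel.Invariant (HiSS.hissKernel U η Φ L G) (HiSS.jointMeasure U η) ∧
        HiSS.IsRecurrent (HiSS.jointMeasure U η) (HiSS.hissKernel U η Φ L G) ∧
        HiSS.VisitsInfinitelyOften (HiSS.jointMeasure U η) (HiSS.hissKernel U η Φ L G) ∧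
        HiSS.HasFiniteMeanReturnTimes (HiSS.jointMeasure U η) (HiSS.hissKernel U η Φ L G)) ∧
      -- arbitrary inner samplers, for which no discrete state is unreachable
      ((∀ (a : Fin d → ℝ) (θ' : HiSS.Dom Θ), ∃ θ : HiSS.Dom Θ, 0 < Φ (θ, a) {θ'}) →
        HiSS.IsRecurrent (HiSS.jointMeasure U η) (HiSS.hissKernel U η Φ L G) ∧
        HiSS.VisitsInfinitelyOften (HiSS.jointMeasure U η) (HiSS.hissKernel U η Φ L G) ∧
        HiSS.HasFiniteMeanReturnTimes (HiSS.jointMeasure U η) (HiSS.hissKernel U η Φ L G)) := by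
  have := HiSS.nonempty_dom hΘ
  have := HiSS.isMarkovKernel_sweep U hη Φ L
  have hK : IsMarkovKernel (HiSS.hissKernel U η Φ L G) := HiSS.isMarkovKernel_pow G
  have hrec : (∀ (a : Fin d → ℝ) (θ' : HiSS.Dom Θ), ∃ θ : HiSS.Dom Θ, 0 < Φ (θ, a) {θ'}) →
      HiSS.IsRecurrent (HiSS.jointMeasure U η) (HiSS.hissKernel U η Φ L G) ∧
      HiSS.VisitsInfinitelyOften (HiSS.jointMeasure U η) (HiSS.hissKernel U η Φ L G) ∧
      HiSS.HasFiniteMeanReturnTimes (HiSS.jointMeasure U η) (HiSS.hissKernel U η Φ L G) := by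
    refine fun hΦ => HiSS.recurrent_of_uniform_hitting fun A hA hpA => ?_
    obtain ⟨ε, h0, hε⟩ := HiSS.exists_le_sweep_apply U hη Φ hΦ L hA hpA
    obtain ⟨g, rfl⟩ := Nat.exists_eq_add_of_le' hG
    exact ⟨ε, h0, HiSS.le_pow_succ_apply hA hε g⟩
  refine ⟨HiSS.isProbabilityMeasure_jointMeasure U hη, hK, fun hΦ =>
    ⟨HiSS.invariant_hissKernel U hη Φ hΦ L G, hrec fun a θ' => ?_⟩, hrec⟩
  -- An invariant law that charges every state excludes unreachable states.
  by_contra! h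
  have hb := HiSS.jointDensity_balance_of_invariant U hη Φ a (hΦ a) θ'
  rw [Finset.sum_eq_zero fun θ _ => by rw [le_antisymm (h θ) bot_le, mul_zero]] at hb
  exact (ENNReal.ofReal_pos.2 (HiSS.jointDensity_pos U hη θ' a)).ne hb
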